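/- An acyclic moral orientation (AMO) of an undirected graph $G$ is an acyclic orientation of all its edges without a $v$-structure (an induced subgraph $u\to c\leftarrow v$ with $u,v$ non-adjacent). Consider the following algorithm \textsc{mcs-enum} for listing the AMOs of a chordal graph $G=(V,E)$ with $n=|V|\ge 1$ vertices and $m=|E|$ edges; $\mathrm{Ne}(x)$ denotes the set of neighbors of $x$. Let $A[0],A[1],\dots$ be sets of vertices with $A[0]=V$ and all others empty, let $\tau$ be the empty list, and call $\mathrm{enumerate}(G,A,\tau)$, which is the following recursive procedure. If $|\tau|=n$, output the orientation of $G$ with $a\to b$ whenever $a$ precedes $b$ in $\tau$, and return. Otherwise let $i$ be the highest index with $A[i]\ne\emptyset$, let $v$ be any vertex of $A[i]$, put $x:=v$, and repeat the following: (1) delete $x$ from $A[i]$, append $x$ to $\tau$, and move each $w\in \mathrm{Ne}(x)\setminus\tau$ from the set $A[j]$ that contains it to $A[j+1]$; (2) call $\mathrm{enumerate}(G,A,\tau)$; (3) undo the changes of (1): move each $w\in \mathrm{Ne}(x)\setminus\tau$ from the set $A[j]$ that contains it to $A[j-1]$, insert $x$ in $A[i]$ and remove $x$ from the end of $\tau$;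 (4) if $x=v$, let $R$ be the set of vertices $a\neq v$ reachable from $v$ in the induced subgraph $G[A[i]]$; (5) if $R=\emptyset$, return; otherwise remove a vertex from $R$, let $x$ be this vertex, and continue with (1). The algorithm is executed on a unit-cost machine with arrays and pointers: $G$ is given by adjacency lists (in any order), the sets $A[j]$ are doubly linked lists (with insertion at the front, and $v$ being the first vertex of $A[i]$), $i$ is found by scanning the array $A$ downwards from one more than the value of $i$ in the calling activation, $R$ is computed by a graph search, and each orientation is written out edge by edge. \textbf{Theorem.} \textsc{mcs-enum} has worst-case delay $O(n+m)$. That is, there is a universal constant $C$ such that, for every non-empty finite chordal graph $G$ with $n$ vertices and $m$ edges and every presentation of $G$ by adjacency lists, the algorithm terminates, and it makes at most $C\,(n+m)$ elementary steps from its start to the first output, between any two consecutive outputs, and from the last output to its termination. -/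

import Mathlib

/-- A graph is chordal if no four or more of its vertices induce a cycle. -/
def IsChordal {V : Type*} (G : SimpleGraph V) : Prop :=
  ∀ k : ℕ, 4 ≤ k → IsEmpty (SimpleGraph.cycleGraph k ↪g G)

/-- An adjacency-list presentation of a graph: a list of the vertices and, for every vertex,
a list of its neighbors. -/
structure AdjLists (V : Type*) where
  verts : List V
  adj : V → List V

/-- The lists contain exactly the vertices of `G`, respectively the neighbors of each vertex,
without repetition and in any order. -/
structure AdjLists.Represents {V : Type*} (I : AdjLists V) (G : SimpleGraph V) : Prop where
  verts_nodup : I.verts.Nodup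
  mem_verts : ∀ v, v ∈ I.verts
  adj_nodup : ∀ v, (I.adj v).Nodup
  mem_adj : ∀ v w, w ∈ I.adj v ↔ G.Adj v w

namespace McsEnum

variable {V : Type*}

/-- The memory of the machine.  The array `A` of sets of vertices is kept as an array of doubly
linked lists: `head j` is the first vertex of `A[j]`, `next w` and `prev w` are the vertices after
and before `w` in its list, and `idx w` is the index of the set that contains `w`.  The ordering
`τ` is a stack (last vertex first) together with its length `len`; `inTau w` says whether `w`
occurs in `τ`, and then `pos w` is its position.  `mark` is used by the graph search.
`outputs` is the output tape, the latest output first; an output is a list of directed edges. -/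
structure Mem (V : Type*) where
  head : ℕ → Option V
  next : V → Option V
  prev : V → Option V
  idx : V → ℕ
  tau : List V
  len : ℕ
  inTau : V → Bool
  pos : V → ℕ
  mark : V → Bool
  outputs : List (List (V × V))

/-- The memory before the start of the program. -/
def Mem.blank (V : Type*) : Mem V where
  head := fun _ => none
  next := fun _ => none
  prev := fun _ => none
  idx := fun _ => 0
  tau := []
  len := 0
  inTau := fun _ => false
  pos := fun _ => 0
  mark := fun _ => false
  outputs := []

variable [DecidableEq V]

/-- `delete w from A[j]`: unlink `w` from the doubly linked list with index `j`. -/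
def Mem.delete (M : Mem V) (j : ℕ) (w : V) : Mem V :=
  let M₁ : Mem V := match M.prev w with
    | none => { M with head := Function.update M.head j (M.next w) }
    | some p => { M with next := Function.update M.next p (M.next w) }
  match M.next w with
    | none => M₁
    | some q => { M₁ with prev := Function.update M₁.prev q (M.prev w) }

/-- `insert w in A[j]`: link `w` at the front of the doubly linked list with index `j`. -/
def Mem.insert (M : Mem V) (j : ℕ) (w : V) : Mem V :=
  let M₁ : Mem V := match M.head j with
    | none => M
    | some h => { M with prev := Function.update M.prev h (some w) }
  { M₁ with
    next := Function.update M₁.next w (M.head j)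
    prev := Function.update M₁.prev w none
    head := Function.update M₁.head j (some w)
    idx := Function.update M₁.idx w j }

/-- `append x to τ`. -/
def Mem.push (M : Mem V) (x : V) : Mem V :=
  { M with
    tau := x :: M.tau
    inTau := Function.update M.inTau x true
    pos := Function.update M.pos x M.len
    len := M.len + 1 }

/-- `pop x from τ`, where `x` is the last vertex of `τ`. -/
def Mem.pop (M : Mem V) (x : V) : Mem V :=
  { M with
    tau := M.tau.tail
    inTau := Function.update M.inTau x false
    len := M.len - 1 }

/-- The local variables of an activation of `enumerate`. -/
structure Frame (V : Type*) where
  i : ℕ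
  v : V
  x : V
  R : List V

/-- Program counter, together with the loop variables of the loop that is being executed. The
arguments of type `List V` are pointers into a list whose remaining part has yet to be treated,
or, for `todo`, a stack. -/
inductive PC (V : Type*) where
  /-- `A :=` array of `n` empty sets; the entries before `j` have been set. -/
  | initSets (j : ℕ)
  /-- `A[0] := V`; the vertices in `vs` have yet to be inserted. -/
  | initVerts (vs : List V)
  /-- Entry of `enumerate`; the sets `A[j]` with `j > h` are empty. -/
  | call (h : ℕ)
  /-- Search for the highest index of a non-empty set in `A`, at `h`. -/
  | scan (h : ℕ)
  /-- Start of the body of the do-while loop: delete `x` from `A[i]`. -/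
  | remove
  /-- Append `x` to `τ`. -/
  | append
  /-- First for-loop over the neighbors of `x`. -/
  | forward (ws : List V)
  /-- Return from a call of `enumerate` to the activation on top of the stack. -/
  | ret
  /-- Second for-loop over the neighbors of `x`. -/
  | backward (ws : List V)
  /-- Insert `x` in `A[i]`, pop `x` from `τ`, and test whether `x = v`. -/
  | restore
  /-- Graph search from `v` in `G[A[i]]`, outer loop; `todo` holds the vertices found whose
  neighbors have yet to be inspected. -/
  | searchVert (todo : List V)
  /-- Graph search, inner loop over the neighbors of one vertex. -/
  | searchNbr (ws todo : List V)
  /-- Clear the marks that were set by the graph search. -/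
  | unmark (ws : List V)
  /-- Test whether `R` is non-empty; if so pop `x` from `R`, else leave the loop. -/
  | loopTest
  /-- Writing the orientation of `G` according to `τ`, outer loop over the vertices. -/
  | outVert (us : List V) (buf : List (V × V))
  /-- Writing the orientation, inner loop over the neighbors of `u`. -/
  | outNbr (u : V) (ws us : List V) (buf : List (V × V))

/-- A configuration: program counter, stack of the activations of `enumerate` (innermost first),
and memory. -/
structure Config (V : Type*) where
  pc : PC V
  stack : List (Frame V)
  mem : Mem V

/-- The start of the program. -/
def start (V : Type*) : Config V := ⟨.initSets 0, [], Mem.blank V⟩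

/-- One elementary step of `mcs-enum` on the graph presented by `I`; `none` means that the program
has terminated.  Every step reads and writes a bounded number of memory cells. -/
def step (I : AdjLists V) (c : Config V) : Option (Config V) :=
  let M := c.mem
  match c.pc, c.stack with
  -- initialization
  | .initSets j, fs =>
      if j < I.verts.length then
        some ⟨.initSets (j + 1), fs, { M with head := Function.update M.head j none }⟩
      else some ⟨.initVerts I.verts, fs, { M with tau := [], len := 0 }⟩
  | .initVerts (v :: vs), fs =>
      some ⟨.initVerts vs, fs,
        { M.insert 0 v with
          inTau := Function.update M.inTau v false
          mark := Function.update M.mark v false }⟩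
  | .initVerts [], fs => some ⟨.call 0, fs, M⟩
  -- if `|τ| = n`, output the orientation; otherwise look for the highest-index non-empty set
  | .call h, fs =>
      if M.len = I.verts.length then some ⟨.outVert I.verts [], fs, M⟩
      else some ⟨.scan h, fs, M⟩
  | .outVert (u :: us) buf, fs => some ⟨.outNbr u (I.adj u) us buf, fs, M⟩
  | .outNbr u (w :: ws) us buf, fs =>
      if M.pos u < M.pos w then some ⟨.outNbr u ws us ((u, w) :: buf), fs, M⟩
      else some ⟨.outNbr u ws us buf, fs, M⟩
  | .outNbr _ [] us buf, fs => some ⟨.outVert us buf, fs, M⟩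
  | .outVert [] buf, fs => some ⟨.ret, fs, { M with outputs := buf :: M.outputs }⟩
  -- `i :=` highest index of a non-empty set, `v :=` a vertex from `A[i]`, `x := v`
  | .scan h, fs =>
      match M.head h with
      | none => some ⟨.scan (h - 1), fs, M⟩
      | some v => some ⟨.remove, ⟨h, v, v, []⟩ :: fs, M⟩
  -- do-while loop, first half
  | .remove, f :: fs => some ⟨.append, f :: fs, M.delete f.i f.x⟩
  | .append, f :: fs => some ⟨.forward (I.adj f.x), f :: fs, M.push f.x⟩
  | .forward (w :: ws), f :: fs =>
      if M.inTau w then some ⟨.forward ws, f :: fs, M⟩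
      else some ⟨.forward ws, f :: fs, (M.delete (M.idx w) w).insert (M.idx w + 1) w⟩
  | .forward [], f :: fs => some ⟨.call (f.i + 1), f :: fs, M⟩
  -- the outermost call of `enumerate` returns
  | .ret, [] => none
  -- do-while loop, second half, after the recursive call
  | .ret, f :: fs => some ⟨.backward (I.adj f.x), f :: fs, M⟩
  | .backward (w :: ws), f :: fs =>
      if M.inTau w then some ⟨.backward ws, f :: fs, M⟩
      else some ⟨.backward ws, f :: fs, (M.delete (M.idx w) w).insert (M.idx w - 1) w⟩
  | .backward [], f :: fs => some ⟨.restore, f :: fs, M⟩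
  | .restore, f :: fs =>
      let M₁ := (M.insert f.i f.x).pop f.x
      if f.x = f.v then
        some ⟨.searchVert [f.v], { f with R := [] } :: fs,
          { M₁ with mark := Function.update M₁.mark f.v true }⟩
      else some ⟨.loopTest, f :: fs, M₁⟩
  -- `R :=` the vertices other than `v` that are reachable from `v` in `G[A[i]]`
  | .searchVert (u :: todo), f :: fs => some ⟨.searchNbr (I.adj u) todo, f :: fs, M⟩
  | .searchNbr (w :: ws) todo, f :: fs =>
      if M.inTau w = false ∧ M.idx w = f.i ∧ M.mark w = false then
        some ⟨.searchNbr ws (w :: todo), { f with R := w :: f.R } :: fs,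
          { M with mark := Function.update M.mark w true }⟩
      else some ⟨.searchNbr ws todo, f :: fs, M⟩
  | .searchNbr [] todo, f :: fs => some ⟨.searchVert todo, f :: fs, M⟩
  | .searchVert [], f :: fs => some ⟨.unmark (f.v :: f.R), f :: fs, M⟩
  | .unmark (w :: ws), f :: fs =>
      some ⟨.unmark ws, f :: fs, { M with mark := Function.update M.mark w false }⟩
  | .unmark [], f :: fs => some ⟨.loopTest, f :: fs, M⟩
  -- while `R` is non-empty, `x := pop(R)`
  | .loopTest, f :: fs =>
      match f.R with
      | [] => some ⟨.ret, fs, M⟩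
      | y :: R => some ⟨.remove, { f with x := y, R := R } :: fs, M⟩
  -- cannot occur: the body of `enumerate` is executed without an activation
  | _, [] => none

/-- The configuration after `t` steps (the last one, if the program has terminated before). -/
def configAt (I : AdjLists V) (t : ℕ) : Config V :=
  (fun c => (step I c).getD c)^[t] (start V)

/-- The `t`-th step completes an output. -/
def OutputsAt (I : AdjLists V) (t : ℕ) : Prop :=
  ∃ s, t = s + 1 ∧
    (configAt I s).mem.outputs.length < (configAt I t).mem.outputs.length

/-- The program terminates after exactly `t` steps. -/
def HaltsAt (I : AdjLists V) (t : ℕ) : Prop :=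
  step I (configAt I t) = none ∧ ∀ s < t, step I (configAt I s) ≠ none

/-- The events between which the delay is measured: the start, the outputs, the termination. -/
def IsEvent (I : AdjLists V) (t : ℕ) : Prop :=
  t = 0 ∨ OutputsAt I t ∨ HaltsAt I t

/-- `mcs-enum` has delay at most `D` on the graph presented by `I`: it terminates, and there are
at most `D` steps from the start to the first output, between any two consecutive outputs, and
from the last output to the termination. -/
def DelayAtMost (I : AdjLists V) (D : ℕ) : Prop :=
  (∃ T, HaltsAt I T) ∧
    ∀ s t, IsEvent I s → IsEvent I t → s < t →
      (∀ r, s < r → r < t → ¬ IsEvent I r) → t - s ≤ D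

end McsEnum

/-!
The argument bounds the time to the next event by a potential that drops in every step without an
output.

The state of the program between two passes through its inner loops is determined by the stack of
activations: the ordering `τ` is formed by the vertices `x` of the activations, and the index of the
set that contains `w` is the number of vertices of `τ` that are adjacent to `w` (`label`). So
undoing a move really restores the sets, although the order within the linked lists may change,
and a vertex of `R` is still in `A[i]` when its turn comes. This is the invariant `Inv`. It implies
that `A` has a non-empty set whenever `|τ| < n`, so that every call of `enumerate` descends to an
output.

The time between two outputs consists of three parts.

* Returning from activations (`ascentCost`): the loops over the neighbors of the vertices `x`, which
  are distinct along the stack, take `O(n + m)` in total. A graph search that finds nothing inspects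
  the neighbors of `v` only, and is paid in the same way.
* At most one graph search with a non-empty result (`searchCost`), since after it the algorithm
  descends.
* Descending to the next output (`descentCost`): each vertex is appended once and its neighbors are
  inspected. The scans for the index `i` telescope, because a scan starts only one above the index
  in the calling activation. Writing the output takes `outputCost`.

The last two parts are held in stock while the program ascends (`reserve`); they are released when a
search finds its first vertex. The lemma `advances_of_step` shows that every step keeps the
invariant and either lowers the potential or makes an output, after which the potential is at most
`delayBound`. In the latter case a bound for the number of outputs to come (`remaining`) drops,
which gives termination. Finally `delayBound` is compared with `n + m` by the handshake lemma.
-/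

namespace McsEnum

variable {V : Type*}

/-! ### The doubly linked lists -/

/-- The lists in the memory `M` are intact and contain exactly the vertices in `S`.  The conditions
on the pointers are local; the rank function excludes circular lists, which no pointer from `head`
would reach. -/
structure Mem.Linked (M : Mem V) (S : V → Prop) : Prop where
  head_some : ∀ j w, M.head j = some w → S w ∧ M.idx w = j ∧ M.prev w = none
  prev_none : ∀ w, S w → M.prev w = none → M.head (M.idx w) = some w
  prev_some : ∀ w p, S w → M.prev w = some p → S p ∧ M.idx p = M.idx w ∧ M.next p = some w
  next_some : ∀ w q, S w → M.next w = some q → S q ∧ M.idx q = M.idx w ∧ M.prev q = some w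
  exists_rank : ∃ r : V → ℤ, ∀ w p, S w → M.prev w = some p → r p < r w

/-- A list with a vertex has a first vertex: the one of least rank. -/
theorem Mem.Linked.head_ne_none [Finite V] {M : Mem V} {S : V → Prop} (h : M.Linked S) {w : V}
    (hw : S w) : M.head (M.idx w) ≠ none := by
  obtain ⟨r, hr⟩ := h.exists_rank
  obtain ⟨u, ⟨hu, hi⟩, hmin⟩ := Set.exists_min_image {u | S u ∧ M.idx u = M.idx w} r
    (Set.toFinite _) ⟨w, hw, rfl⟩
  have hp : M.prev u = none := by
    cases hp : M.prev u with
    | none => rfl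
    | some p =>
      have h1 := h.prev_some u p hu hp
      have h2 := hmin p ⟨h1.1, h1.2.1.trans hi⟩
      have h3 := hr u p hu hp
      omega
  rw [← hi, h.prev_none u hu hp]
  simp

section

variable [DecidableEq V] (M : Mem V) (j : ℕ) (w : V)

@[simp] theorem Mem.delete_idx : (M.delete j w).idx = M.idx := by
  unfold Mem.delete; cases M.prev w <;> cases M.next w <;> rfl

@[simp] theorem Mem.delete_len : (M.delete j w).len = M.len := by
  unfold Mem.delete; cases M.prev w <;> cases M.next w <;> rfl

@[simp] theorem Mem.delete_inTau : (M.delete j w).inTau = M.inTau := by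
  unfold Mem.delete; cases M.prev w <;> cases M.next w <;> rfl

@[simp] theorem Mem.delete_mark : (M.delete j w).mark = M.mark := by
  unfold Mem.delete; cases M.prev w <;> cases M.next w <;> rfl

@[simp] theorem Mem.delete_outputs : (M.delete j w).outputs = M.outputs := by
  unfold Mem.delete; cases M.prev w <;> cases M.next w <;> rfl

@[simp] theorem Mem.insert_idx : (M.insert j w).idx = Function.update M.idx w j := by
  unfold Mem.insert; cases M.head j <;> rfl

@[simp] theorem Mem.insert_len : (M.insert j w).len = M.len := by
  unfold Mem.insert; cases M.head j <;> rfl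

@[simp] theorem Mem.insert_inTau : (M.insert j w).inTau = M.inTau := by
  unfold Mem.insert; cases M.head j <;> rfl

@[simp] theorem Mem.insert_mark : (M.insert j w).mark = M.mark := by
  unfold Mem.insert; cases M.head j <;> rfl

@[simp] theorem Mem.insert_outputs : (M.insert j w).outputs = M.outputs := by
  unfold Mem.insert; cases M.head j <;> rfl

variable {M j w}

theorem Mem.Linked.delete {S : V → Prop} (h : M.Linked S) (hw : S w) (hj : M.idx w = j) :
    (M.delete j w).Linked fun u => S u ∧ u ≠ w := by
  obtain ⟨h1, h2, h3, h4, r, hr⟩ := h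
  have h5 : ∀ q, M.next w = some q → r w < r q := fun q hq =>
    hr q w (h4 w q hw hq).1 (h4 w q hw hq).2.2
  refine ⟨?_, ?_, ?_, ?_, r, ?_⟩ <;> unfold Mem.delete <;>
    cases hp : M.prev w <;> cases hn : M.next w <;>
    simp only [Function.update_apply] <;> grind

theorem Mem.Linked.insert [Finite V] {S : V → Prop} (h : M.Linked S) (hw : ¬ S w) :
    (M.insert j w).Linked fun u => S u ∨ u = w := by
  obtain ⟨h1, h2, h3, h4, r, hr⟩ := h
  obtain ⟨b, hb⟩ := (Set.finite_range r).bddBelow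
  have hb' : ∀ u, b ≤ r u := fun u => hb ⟨u, rfl⟩
  -- the new first vertex gets a rank below all others
  refine ⟨?_, ?_, ?_, ?_, Function.update r w (b - 1), ?_⟩ <;> unfold Mem.insert <;>
    cases hh : M.head j <;>
    simp only [Function.update_apply] <;> grind

end

/-! ### The invariant -/

/-- The memory `M` holds the ordering `τ` (last vertex first), lists with exactly the vertices in
`S`, where the list of `w` has index `κ w`, and marks on exactly the vertices in `K`. -/
structure Mem.Models (M : Mem V) (τ : List V) (S : V → Prop) (κ : V → ℕ) (K : V → Prop) :
    Prop where
  len_eq : M.len = τ.length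
  inTau_iff : ∀ w, M.inTau w = true ↔ w ∈ τ
  linked : M.Linked S
  idx_eq : ∀ w, S w → M.idx w = κ w
  mark_iff : ∀ w, M.mark w = true ↔ K w

variable [DecidableEq V]

namespace Mem.Models

variable {M : Mem V} {τ : List V} {S S' : V → Prop} {κ κ' : V → ℕ} {K K' : V → Prop} {j : ℕ}
  {x w : V}

omit [DecidableEq V] in
theorem congr (h : M.Models τ S κ K) (hS : ∀ w, S w ↔ S' w) (hκ : ∀ w, S w → κ w = κ' w)
    (hK : ∀ w, K w ↔ K' w) : M.Models τ S' κ' K' := by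
  obtain rfl : S = S' := funext fun w => propext (hS w)
  exact ⟨h.len_eq, h.inTau_iff, h.linked, fun w hw => (h.idx_eq w hw).trans (hκ w hw),
    fun w => (h.mark_iff w).trans (hK w)⟩

theorem delete (h : M.Models τ S κ K) (hw : S w) (hj : κ w = j) :
    (M.delete j w).Models τ (fun u => S u ∧ u ≠ w) κ K :=
  ⟨by simpa using h.len_eq, by simpa using h.inTau_iff,
    h.linked.delete hw ((h.idx_eq w hw).trans hj), by simpa using fun u hu _ => h.idx_eq u hu,
    by simpa using h.mark_iff⟩

theorem insert [Finite V] (h : M.Models τ S κ K) (hw : ¬ S w) :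
    (M.insert j w).Models τ (fun u => S u ∨ u = w) (Function.update κ w j) K := by
  refine ⟨by simpa using h.len_eq, by simpa using h.inTau_iff, h.linked.insert hw, ?_,
    by simpa using h.mark_iff⟩
  have := h.idx_eq
  simp only [insert_idx, Function.update_apply]
  grind

theorem move [Finite V] (h : M.Models τ S κ K) (hw : S w) :
    ((M.delete (M.idx w) w).insert j w).Models τ S (Function.update κ w j) K :=
  ((h.delete hw (h.idx_eq w hw).symm).insert (by simp)).congr (by grind) (fun _ _ => rfl)
    fun _ => Iff.rfl

theorem push (h : M.Models τ S κ K) : (M.push x).Models (x :: τ) S κ K where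
  len_eq := by simp [Mem.push, h.len_eq]
  inTau_iff w := by
    have := h.inTau_iff w
    simp only [Mem.push, Function.update_apply]
    grind
  linked := ⟨h.linked.1, h.linked.2, h.linked.3, h.linked.4, h.linked.5⟩
  idx_eq := h.idx_eq
  mark_iff := h.mark_iff

theorem pop (h : M.Models (x :: τ) S κ K) (hx : x ∉ τ) : (M.pop x).Models τ S κ K where
  len_eq := by simp [Mem.pop, h.len_eq]
  inTau_iff w := by
    have := h.inTau_iff w
    simp only [Mem.pop, Function.update_apply]
    grind
  linked := ⟨h.linked.1, h.linked.2, h.linked.3, h.linked.4, h.linked.5⟩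
  idx_eq := h.idx_eq
  mark_iff := h.mark_iff

theorem set_mark (h : M.Models τ S κ K) (b : Bool) :
    Mem.Models { M with mark := Function.update M.mark w b } τ S κ
      (fun u => if u = w then b = true else K u) where
  len_eq := h.len_eq
  inTau_iff := h.inTau_iff
  linked := ⟨h.linked.1, h.linked.2, h.linked.3, h.linked.4, h.linked.5⟩
  idx_eq := h.idx_eq
  mark_iff u := by
    have := h.mark_iff u
    simp only [Function.update_apply]
    grind

end Mem.Models

/-- The number of neighbors of `w` that precede it, when the ordering so far is `τ`.  This is the
index of the set that contains `w` whenever no neighbors are being moved. -/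
def label (I : AdjLists V) (τ : List V) (w : V) : ℕ := τ.countP fun x => w ∈ I.adj x

/-- The memory at the entry and at the return of an activation of `enumerate` with ordering `τ`. -/
def Mem.Stable (I : AdjLists V) (τ : List V) (M : Mem V) : Prop :=
  M.Models τ (fun w => w ∉ τ) (label I τ) fun _ => False

/-- The vertices that the activations on the stack have appended to the ordering (last one
first). -/
def path (fs : List (Frame V)) : List V := fs.map Frame.x

/-- The local variables of an activation that was entered with the ordering `τ`: `i` is the highest
label of a vertex outside `τ`, the vertices `x` and `R`, which are those treated now and later, have
this label, and `v` is not treated again. -/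
structure Frame.Valid (I : AdjLists V) (τ : List V) (f : Frame V) : Prop where
  notMem : ∀ w ∈ f.x :: f.R, w ∉ τ
  label_eq : ∀ w ∈ f.x :: f.R, label I τ w = f.i
  label_le : ∀ w, w ∉ τ → label I τ w ≤ f.i
  nodup : (f.v :: f.R).Nodup

/-- Every activation on the stack is valid for the ordering produced by the activations below it. -/
def StackValid (I : AdjLists V) : List (Frame V) → Prop
  | [] => True
  | f :: fs => f.Valid I (path fs) ∧ StackValid I fs

/-- The invariant of the program.  The memory is described in terms of the stack alone: the ordering
is the path of the stack (except that `x` is missing before it is appended and after it is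
removed from the end of `τ`), and the index of the set of `w` is the label of `w`, plus one if the
program is in a loop over the neighbors of `x` and `w` is on the part of the list that has already
been moved up or has not yet been moved down. -/
def Inv (I : AdjLists V) (c : Config V) : Prop :=
  match c.pc, c.stack with
  | .initSets _, fs => fs = [] ∧ c.mem.Models [] (fun _ => False) (fun _ => 0) fun _ => False
  | .initVerts vs, fs =>
      fs = [] ∧ vs.Nodup ∧ c.mem.Models [] (fun w => w ∉ vs) (fun _ => 0) fun _ => False
  | .call h, fs => StackValid I fs ∧ c.mem.Stable I (path fs) ∧
      ∀ w, w ∉ path fs → label I (path fs) w ≤ h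
  | .scan h, fs => StackValid I fs ∧ c.mem.Stable I (path fs) ∧
      (∀ w, w ∉ path fs → label I (path fs) w ≤ h) ∧ fs.length < I.verts.length
  | .outVert _ _, fs | .outNbr _ _ _ _, fs | .ret, fs =>
      StackValid I fs ∧ c.mem.Stable I (path fs)
  | .remove, f :: fs | .loopTest, f :: fs => StackValid I (f :: fs) ∧ c.mem.Stable I (path fs)
  | .append, f :: fs => StackValid I (f :: fs) ∧
      c.mem.Models (path fs) (fun w => w ∉ path (f :: fs)) (label I (path fs)) fun _ => False
  | .forward ws, f :: fs => StackValid I (f :: fs) ∧ ws.Nodup ∧ ws ⊆ I.adj f.x ∧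
      c.mem.Models (path (f :: fs)) (fun w => w ∉ path (f :: fs))
        (fun w => label I (path fs) w + if w ∈ I.adj f.x ∧ w ∉ ws then 1 else 0) fun _ => False
  | .backward ws, f :: fs => StackValid I (f :: fs) ∧ ws.Nodup ∧
      c.mem.Models (path (f :: fs)) (fun w => w ∉ path (f :: fs))
        (fun w => label I (path fs) w + if w ∈ ws then 1 else 0) fun _ => False
  | .restore, f :: fs => StackValid I (f :: fs) ∧
      c.mem.Models (path (f :: fs)) (fun w => w ∉ path (f :: fs)) (label I (path fs)) fun _ => False
  | .searchVert _, f :: fs | .searchNbr _ _, f :: fs => StackValid I (f :: fs) ∧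
      c.mem.Models (path fs) (fun w => w ∉ path fs) (label I (path fs)) fun w => w ∈ f.v :: f.R
  | .unmark ws, f :: fs => StackValid I (f :: fs) ∧ ws.Nodup ∧
      c.mem.Models (path fs) (fun w => w ∉ path fs) (label I (path fs)) fun w => w ∈ ws
  | _, [] => False

theorem StackValid.nodup_path {I : AdjLists V} {fs : List (Frame V)} (h : StackValid I fs) :
    (path fs).Nodup := by
  induction fs with
  | nil => simp [path]
  | cons f fs ih => exact List.nodup_cons.2 ⟨h.1.notMem _ (by simp), ih h.2⟩

theorem label_cons (I : AdjLists V) (x : V) (τ : List V) (w : V) :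
    label I (x :: τ) w = label I τ w + if w ∈ I.adj x then 1 else 0 := by
  simp [label, List.countP_cons]

/-! ### The potential -/

section Potential

variable [Fintype V] (I : AdjLists V)

/-- The potential of the vertices that have yet to be appended to the ordering `τ`; it pays for
appending them, including, for each vertex, one step of scanning: the call that follows starts to
scan one above the index of the vertex. -/
def descentCost (τ : List V) : ℕ := ∑ u with u ∉ τ, ((I.adj u).length + 6)

/-- The potential of the vertices that are not marked; it pays for the rest of a graph search that
has found a vertex. -/
def searchCost (M : Mem V) : ℕ := ∑ u with M.mark u = false, ((I.adj u).length + 4)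

/-- The time for writing an output. -/
def outputCost (us : List V) : ℕ := (us.map fun u => (I.adj u).length + 2).sum + 1

/-- The potential of the activations on the stack; it pays for returning from all of them. -/
def ascentCost (fs : List (Frame V)) : ℕ := ((path fs).map fun u => 2 * (I.adj u).length + 9).sum

/-- A bound for the time from the moment at which a graph search finds its first vertex to the next
output: it pays for the search, for the descent, for the scans (the index `i` is at most `n`), and
for writing the output. -/
def reserve : ℕ :=
  ∑ u, ((I.adj u).length + 4) + ∑ u, ((I.adj u).length + 6) + I.verts.length +
    outputCost I I.verts

/-- A bound for the time until the next output or the termination, when the activation `f` is about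
to test whether `R` is empty. -/
def loopCost (f : Frame V) (fs : List (Frame V)) : ℕ :=
  if f.R = [] then ascentCost I fs + reserve I
  else descentCost I (path fs) + f.i + outputCost I I.verts

/-- A bound for the time until the next output or the termination. As long as `R` is empty, a graph
search is charged only for the neighbors of `v`; all that comes after the discovery of a
first vertex is paid by `reserve`, which is used only once before the next output.  The additive
constants count the steps outside of the loops. -/
def potential (c : Config V) : ℕ :=
  match c.pc, c.stack with
  | .initSets j, fs => (I.verts.length - j) + I.verts.length + 2 + descentCost I (path fs) +
      outputCost I I.verts + 2
  | .initVerts vs, fs => vs.length + 1 + descentCost I (path fs) + outputCost I I.verts + 2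
  | .call h, fs => descentCost I (path fs) + h + outputCost I I.verts + 2
  | .scan h, fs => descentCost I (path fs) + h + outputCost I I.verts + 1
  | .outVert us _, _ => outputCost I us
  | .outNbr _ ws us _, _ => ws.length + 1 + outputCost I us
  | .ret, fs => ascentCost I fs + reserve I
  | .remove, f :: fs => descentCost I (path fs) + f.i + outputCost I I.verts
  | .append, f :: fs =>
      descentCost I (path (f :: fs)) + (I.adj f.x).length + f.i + outputCost I I.verts + 5
  | .forward ws, f :: fs =>
      descentCost I (path (f :: fs)) + ws.length + f.i + outputCost I I.verts + 4
  | .backward ws, f :: fs =>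
      ws.length + 8 + (I.adj f.x).length + ascentCost I fs + reserve I
  | .restore, f :: fs => 7 + (I.adj f.x).length + ascentCost I fs + reserve I
  | .searchVert todo, f :: fs => (todo.map fun u => (I.adj u).length + 2).sum + f.R.length + 4 +
      (if f.R = [] then 0 else searchCost I c.mem) + loopCost I f fs
  | .searchNbr ws todo, f :: fs =>
      ws.length + 1 + (todo.map fun u => (I.adj u).length + 2).sum + f.R.length + 4 +
      (if f.R = [] then 0 else searchCost I c.mem) + loopCost I f fs
  | .unmark ws, f :: fs => ws.length + 2 + loopCost I f fs
  | .loopTest, f :: fs => 1 + loopCost I f fs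
  | _, [] => 0

/-- A bound for the potential after an output. -/
def delayBound : ℕ := ∑ u, (2 * (I.adj u).length + 9) + reserve I

variable {I}

theorem descentCost_cons {τ : List V} {x : V} (hx : x ∉ τ) :
    descentCost I τ = descentCost I (x :: τ) + ((I.adj x).length + 6) := by
  have : Finset.univ.filter (fun u => u ∉ τ) =
      insert x (Finset.univ.filter fun u => u ∉ x :: τ) := by
    ext u; simp only [Finset.mem_filter, Finset.mem_univ, Finset.mem_insert]; grind
  rw [descentCost, this, Finset.sum_insert (by simp), descentCost, add_comm]

theorem descentCost_le (τ : List V) : descentCost I τ ≤ ∑ u, ((I.adj u).length + 6) :=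
  Finset.sum_le_sum_of_subset (Finset.filter_subset _ _)

omit [DecidableEq V] in
theorem searchCost_le (M : Mem V) : searchCost I M ≤ ∑ u, ((I.adj u).length + 4) :=
  Finset.sum_le_sum_of_subset (Finset.filter_subset _ _)

theorem searchCost_mark {M : Mem V} {w : V} (hw : M.mark w = false) :
    searchCost I M = searchCost I { M with mark := Function.update M.mark w true } +
      ((I.adj w).length + 4) := by
  have : Finset.univ.filter (fun u => M.mark u = false) =
      insert w (Finset.univ.filter fun u => Function.update M.mark w true u = false) := by
    ext u
    simp only [Finset.mem_filter, Finset.mem_univ, Finset.mem_insert, Function.update_apply]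
    grind
  rw [searchCost, this, Finset.sum_insert (by simp), searchCost, add_comm]

theorem sum_map_le_sum_univ {l : List V} (hl : l.Nodup) (g : V → ℕ) :
    (l.map g).sum ≤ ∑ u, g u := by
  rw [← List.sum_toFinset g hl]
  exact Finset.sum_le_sum_of_subset (Finset.subset_univ _)

theorem ascentCost_le {fs : List (Frame V)} (h : StackValid I fs) :
    ascentCost I fs ≤ ∑ u, (2 * (I.adj u).length + 9) :=
  sum_map_le_sum_univ h.nodup_path _

omit [DecidableEq V] [Fintype V] in
theorem ascentCost_cons (f : Frame V) (fs : List (Frame V)) :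
    ascentCost I (f :: fs) = 2 * (I.adj f.x).length + 9 + ascentCost I fs := by
  simp [ascentCost, path]

theorem _root_.AdjLists.Represents.length_verts {G : SimpleGraph V} (hI : I.Represents G) :
    I.verts.length = Fintype.card V := by
  rw [← List.toFinset_card_of_nodup hI.verts_nodup, ← Finset.card_univ]
  congr 1
  ext u
  simp [hI.mem_verts]

omit [DecidableEq V] [Fintype V] in
theorem _root_.AdjLists.Represents.length_le {G : SimpleGraph V} (hI : I.Represents G) {l : List V}
    (hl : l.Nodup) : l.length ≤ I.verts.length :=
  (List.subperm_of_subset hl fun u _ => hI.mem_verts u).length_le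

omit [Fintype V] in
/-- The indices of the sets do not exceed `n`. -/
theorem StackValid.le_length {G : SimpleGraph V} (hI : I.Represents G) {f : Frame V}
    {fs : List (Frame V)} (h : StackValid I (f :: fs)) : f.i ≤ I.verts.length := by
  rw [← h.1.label_eq f.x (by simp)]
  exact List.countP_le_length.trans (hI.length_le h.2.nodup_path)

theorem loopCost_of_eq_nil {f : Frame V} {fs : List (Frame V)} (h : f.R = []) :
    loopCost I f fs = ascentCost I fs + reserve I := if_pos h

theorem loopCost_of_ne_nil {f : Frame V} {fs : List (Frame V)} (h : f.R ≠ []) :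
    loopCost I f fs = descentCost I (path fs) + f.i + outputCost I I.verts := if_neg h

/-- Going on with another vertex costs at most the reserve, even after a full graph search. -/
theorem add_loopCost_le {G : SimpleGraph V} (hI : I.Represents G) {f : Frame V}
    {fs : List (Frame V)} (h : StackValid I (f :: fs)) :
    ∑ u, ((I.adj u).length + 4) + (descentCost I (path fs) + f.i + outputCost I I.verts) ≤
      reserve I := by
  have := descentCost_le (I := I) (path fs)
  have := h.le_length hI
  unfold reserve
  omega

end Potential

/-! ### The number of outputs to come -/

/-- A bound for the number of recursive calls that an activation has yet to make, after the
present one.  As long as `x = v`, the list `R` has not been computed. -/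
def Frame.pending (I : AdjLists V) (f : Frame V) : ℕ :=
  if f.x = f.v then I.verts.length else f.R.length

/-- A bound for the number of outputs of an activation whose stack of callers has length `d`: it
makes at most `n + 1` calls, and the ordering is complete at depth `n`. -/
def outputBound (I : AdjLists V) (d : ℕ) : ℕ := (I.verts.length + 1) ^ (I.verts.length - d)

/-- A bound for the number of outputs made by the activations on the stack after the present
recursive call. -/
def pendingOutputs (I : AdjLists V) : List (Frame V) → ℕ
  | [] => 0
  | f :: fs => f.pending I * outputBound I (fs.length + 1) + pendingOutputs I fs

/-- A bound for the number of outputs to come. -/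
def remaining (I : AdjLists V) (c : Config V) : ℕ :=
  match c.pc, c.stack with
  | .initSets _, fs | .initVerts _, fs | .call _, fs | .scan _, fs
  | .outVert _ _, fs | .outNbr _ _ _ _, fs => outputBound I fs.length + pendingOutputs I fs
  | .remove, f :: fs | .append, f :: fs | .forward _, f :: fs =>
      outputBound I (fs.length + 1) + pendingOutputs I (f :: fs)
  | .ret, fs | .backward _, fs | .restore, fs => pendingOutputs I fs
  | .searchVert _, _ :: fs | .searchNbr _ _, _ :: fs =>
      I.verts.length * outputBound I (fs.length + 1) + pendingOutputs I fs
  | .unmark _, f :: fs | .loopTest, f :: fs =>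
      f.R.length * outputBound I (fs.length + 1) + pendingOutputs I fs
  | _, [] => 0

omit [DecidableEq V] in
theorem outputBound_pos (I : AdjLists V) (d : ℕ) : 0 < outputBound I d :=
  Nat.pow_pos (Nat.succ_pos _)

omit [DecidableEq V] in
theorem outputBound_eq {I : AdjLists V} {d : ℕ} (h : d < I.verts.length) :
    outputBound I d = outputBound I (d + 1) + I.verts.length * outputBound I (d + 1) := by
  unfold outputBound
  obtain ⟨k, hk⟩ := Nat.exists_eq_add_of_lt h
  rw [show I.verts.length - d = (I.verts.length - (d + 1)) + 1 by omega, pow_succ]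
  ring

/-! ### One step -/

/-- A step from `c` to `c'` keeps the invariant, and either it makes no output and the potential
drops, or it makes an output, the potential is reset to at most `delayBound`, and the
number of outputs to come drops. -/
structure Advances [Fintype V] (I : AdjLists V) (c c' : Config V) : Prop where
  inv : Inv I c'
  cost : (c'.mem.outputs = c.mem.outputs ∧ potential I c' < potential I c ∧
      remaining I c' ≤ remaining I c) ∨
    (c'.mem.outputs.length = c.mem.outputs.length + 1 ∧ potential I c' ≤ delayBound I ∧
      remaining I c' < remaining I c)

section Step

variable [Fintype V] {I : AdjLists V} {G : SimpleGraph V} {M : Mem V} {f : Frame V}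
  {fs : List (Frame V)} {c : Config V}

theorem advances_initSets {j : ℕ} (h : Inv I ⟨.initSets j, fs, M⟩) (hI : I.Represents G)
    (hc : step I ⟨.initSets j, fs, M⟩ = some c) : Advances I ⟨.initSets j, fs, M⟩ c := by
  dsimp only [Inv] at h
  obtain ⟨rfl, h⟩ := h
  simp only [step] at hc
  split_ifs at hc with hj <;> cases hc
  · refine ⟨⟨rfl, h.len_eq, h.inTau_iff, ⟨?_, ?_, ?_, ?_, h.linked.exists_rank⟩, h.idx_eq,
      h.mark_iff⟩, Or.inl ⟨rfl, ?_, le_rfl⟩⟩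
    · intro k w
      have := h.linked.head_some k w
      simp only [Function.update_apply]
      grind
    · simp
    · simp
    · simp
    · simp only [potential]; omega
  · refine ⟨⟨rfl, hI.verts_nodup, rfl, h.inTau_iff, ?_, ?_, h.mark_iff⟩,
      Or.inl ⟨rfl, ?_, le_rfl⟩⟩
    · have : (fun w => w ∉ I.verts) = fun _ => False := by
        funext w; simp [hI.mem_verts]
      rw [this]
      exact ⟨h.linked.1, h.linked.2, h.linked.3, h.linked.4, h.linked.5⟩
    · intro w hw; exact absurd (hI.mem_verts w) hw
    · simp only [potential]; omega

theorem advances_initVerts {vs : List V} (h : Inv I ⟨.initVerts vs, fs, M⟩)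
    (hc : step I ⟨.initVerts vs, fs, M⟩ = some c) : Advances I ⟨.initVerts vs, fs, M⟩ c := by
  dsimp only [Inv] at h
  obtain ⟨rfl, hn, h⟩ := h
  cases vs with
  | nil =>
    simp only [step] at hc
    cases hc
    refine ⟨⟨trivial, h.congr ?_ ?_ fun _ => Iff.rfl, ?_⟩, Or.inl ⟨rfl, ?_, le_rfl⟩⟩
    · simp [path]
    · simp [path, label]
    · simp [path, label]
    · simp only [potential]; simp
  | cons v vs =>
    simp only [step] at hc
    cases hc
    have h1 := h.insert (w := v) (j := 0) (by simp)
    have hin : Function.update M.inTau v false = (M.insert 0 v).inTau := by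
      funext u
      have := h.inTau_iff u
      simp only [Mem.insert_inTau, Function.update_apply]
      grind
    refine ⟨⟨rfl, hn.of_cons, ?_⟩, Or.inl ⟨by simp, ?_, le_rfl⟩⟩
    · have h2 := h1.set_mark (w := v) false
      simp only [Mem.insert_mark] at h2
      simp only [hin]
      refine h2.congr ?_ ?_ ?_
      · have := List.nodup_cons.1 hn
        grind
      · simp [Function.update_apply]
      · simp
    · simp only [potential, List.length_cons]; omega

theorem advances_call {k : ℕ} (h : Inv I ⟨.call k, fs, M⟩) (hI : I.Represents G)
    (hc : step I ⟨.call k, fs, M⟩ = some c) : Advances I ⟨.call k, fs, M⟩ c := by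
  dsimp only [Inv] at h
  obtain ⟨hs, hm, hk⟩ := h
  simp only [step] at hc
  have hl := hm.len_eq
  have hle := hI.length_le hs.nodup_path
  split_ifs at hc with hj <;> cases hc
  · refine ⟨⟨hs, hm⟩, Or.inl ⟨rfl, ?_, le_rfl⟩⟩
    simp only [potential]; omega
  · refine ⟨⟨hs, hm, hk, ?_⟩, Or.inl ⟨rfl, ?_, le_rfl⟩⟩
    · simp only [path, List.length_map] at hl hle; dsimp only; omega
    · simp only [potential]; omega

theorem advances_outVert {us : List V} {buf : List (V × V)}
    (h : Inv I ⟨.outVert us buf, fs, M⟩)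
    (hc : step I ⟨.outVert us buf, fs, M⟩ = some c) : Advances I ⟨.outVert us buf, fs, M⟩ c := by
  dsimp only [Inv] at h
  obtain ⟨hs, hm⟩ := h
  cases us with
  | nil =>
    simp only [step] at hc
    cases hc
    refine ⟨⟨hs, hm.len_eq, hm.inTau_iff, ?_, hm.idx_eq, hm.mark_iff⟩,
      Or.inr ⟨rfl, ?_, ?_⟩⟩
    · have := hm.linked
      exact ⟨this.1, this.2, this.3, this.4, this.5⟩
    · simp only [potential, delayBound]
      have := ascentCost_le hs
      omega
    · simp only [remaining]
      have := outputBound_pos I fs.length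
      omega
  | cons u us =>
    simp only [step] at hc
    cases hc
    refine ⟨⟨hs, hm⟩, Or.inl ⟨rfl, ?_, le_rfl⟩⟩
    simp only [potential, outputCost, List.map_cons, List.sum_cons]; omega

theorem advances_outNbr {u : V} {ws us : List V} {buf : List (V × V)}
    (h : Inv I ⟨.outNbr u ws us buf, fs, M⟩)
    (hc : step I ⟨.outNbr u ws us buf, fs, M⟩ = some c) :
    Advances I ⟨.outNbr u ws us buf, fs, M⟩ c := by
  cases ws with
  | nil =>
    simp only [step] at hc
    cases hc
    refine ⟨h, Or.inl ⟨rfl, ?_, le_rfl⟩⟩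
    simp only [potential, List.length_nil]; omega
  | cons w ws =>
    simp only [step] at hc
    split_ifs at hc <;> cases hc <;>
    · refine ⟨h, Or.inl ⟨rfl, ?_, le_rfl⟩⟩
      simp only [potential, List.length_cons]; omega

theorem advances_scan {k : ℕ} (h : Inv I ⟨.scan k, fs, M⟩) (hI : I.Represents G)
    (hc : step I ⟨.scan k, fs, M⟩ = some c) : Advances I ⟨.scan k, fs, M⟩ c := by
  dsimp only [Inv] at h
  obtain ⟨hs, hm, hk, hlt⟩ := h
  simp only [step] at hc
  split at hc <;> rename_i hh <;> cases hc
  -- `A[k]` is empty, so that all labels are less than `k`; as some vertex is left, `k` is positive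
  · have hk' : ∀ w, w ∉ path fs → label I (path fs) w < k := by
      intro w hw
      refine lt_of_le_of_ne (hk w hw) fun he => ?_
      have := hm.linked.head_ne_none hw
      rw [hm.idx_eq w hw, he] at this
      exact this hh
    have hpos : 0 < k := by
      obtain ⟨w, hw⟩ : ∃ w, w ∉ path fs := by
        by_contra! hall
        have := (List.subperm_of_subset hI.verts_nodup fun u _ => hall u).length_le
        simp only [path, List.length_map] at this
        omega
      exact (Nat.zero_le _).trans_lt (hk' w hw)
    refine ⟨⟨hs, hm, fun w hw => Nat.le_sub_one_of_lt (hk' w hw), hlt⟩, Or.inl ⟨rfl, ?_, le_rfl⟩⟩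
    simp only [potential]; omega
  · rename_i v
    have hv := hm.linked.head_some k v hh
    refine ⟨⟨⟨⟨?_, ?_, hk, by simp⟩, hs⟩, hm⟩, Or.inl ⟨rfl, ?_, ?_⟩⟩
    · simpa using hv.1
    · simpa using (hm.idx_eq v hv.1).symm.trans hv.2.1
    · simp only [potential]; omega
    · simp only [remaining, pendingOutputs, Frame.pending, if_true]
      have := outputBound_eq hlt
      omega

theorem advances_remove (h : Inv I ⟨.remove, f :: fs, M⟩)
    (hc : step I ⟨.remove, f :: fs, M⟩ = some c) : Advances I ⟨.remove, f :: fs, M⟩ c := by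
  dsimp only [Inv] at h
  obtain ⟨hs, hm⟩ := h
  have hx := hs.1.notMem f.x (by simp)
  simp only [step] at hc
  cases hc
  refine ⟨⟨hs, (hm.delete hx (hs.1.label_eq f.x (by simp))).congr ?_ (fun _ _ => rfl)
    fun _ => Iff.rfl⟩, Or.inl ⟨by simp, ?_, le_rfl⟩⟩
  · intro w; simp only [path, List.map_cons, List.mem_cons]; tauto
  · have := descentCost_cons (I := I) hx
    simp only [potential]
    simp only [path, List.map_cons] at this ⊢
    omega

theorem advances_append (h : Inv I ⟨.append, f :: fs, M⟩) (hI : I.Represents G)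
    (hc : step I ⟨.append, f :: fs, M⟩ = some c) : Advances I ⟨.append, f :: fs, M⟩ c := by
  dsimp only [Inv] at h
  obtain ⟨hs, hm⟩ := h
  simp only [step] at hc
  cases hc
  refine ⟨⟨hs, hI.adj_nodup _, fun _ => id, hm.push.congr (fun _ => Iff.rfl) (fun w _ => ?_)
    fun _ => Iff.rfl⟩, Or.inl ⟨rfl, ?_, le_rfl⟩⟩
  · grind
  · simp only [potential]; omega

theorem advances_forward {ws : List V} (h : Inv I ⟨.forward ws, f :: fs, M⟩)
    (hc : step I ⟨.forward ws, f :: fs, M⟩ = some c) :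
    Advances I ⟨.forward ws, f :: fs, M⟩ c := by
  dsimp only [Inv] at h
  obtain ⟨hs, hn, hsub, hm⟩ := h
  cases ws with
  | nil =>
    simp only [step] at hc
    cases hc
    refine ⟨⟨hs, hm.congr (fun _ => Iff.rfl) (fun w _ => ?_) fun _ => Iff.rfl, fun w hw => ?_⟩,
      Or.inl ⟨rfl, ?_, le_rfl⟩⟩
    · simp [path, label_cons]
    · have := hs.1.label_le w (by simp [path] at hw ⊢; tauto)
      simp only [path, List.map_cons, label_cons] at this ⊢
      split_ifs <;> omega
    · simp only [potential, List.length_nil]; omega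
  | cons w ws =>
    have hn' := List.nodup_cons.1 hn
    have hsub' := List.cons_subset.1 hsub
    have hin := hm.inTau_iff w
    simp only [step] at hc
    split_ifs at hc with hw <;> cases hc
    · refine ⟨⟨hs, hn'.2, hsub'.2, hm.congr (fun _ => Iff.rfl) (fun u hu => ?_) fun _ => Iff.rfl⟩,
        Or.inl ⟨rfl, ?_, le_rfl⟩⟩
      · grind
      · simp only [potential, List.length_cons]; omega
    · have hw' : w ∉ path (f :: fs) := by grind
      refine ⟨⟨hs, hn'.2, hsub'.2, (hm.move hw').congr (fun _ => Iff.rfl) (fun u hu => ?_)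
        fun _ => Iff.rfl⟩, Or.inl ⟨by simp, ?_, le_rfl⟩⟩
      · have hi := hm.idx_eq w hw'
        simp only [Function.update_apply]
        grind
      · simp only [potential, List.length_cons]; omega

theorem advances_ret (h : Inv I ⟨.ret, f :: fs, M⟩) (hI : I.Represents G)
    (hc : step I ⟨.ret, f :: fs, M⟩ = some c) : Advances I ⟨.ret, f :: fs, M⟩ c := by
  dsimp only [Inv] at h
  obtain ⟨hs, hm⟩ := h
  simp only [step] at hc
  cases hc
  refine ⟨⟨hs, hI.adj_nodup _, hm.congr (fun _ => Iff.rfl) (fun w _ => ?_) fun _ => Iff.rfl⟩,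
    Or.inl ⟨rfl, ?_, le_rfl⟩⟩
  · simp [path, label_cons]
  · simp only [potential, ascentCost_cons]; omega

theorem advances_backward {ws : List V} (h : Inv I ⟨.backward ws, f :: fs, M⟩)
    (hc : step I ⟨.backward ws, f :: fs, M⟩ = some c) :
    Advances I ⟨.backward ws, f :: fs, M⟩ c := by
  dsimp only [Inv] at h
  obtain ⟨hs, hn, hm⟩ := h
  cases ws with
  | nil =>
    simp only [step] at hc
    cases hc
    refine ⟨⟨hs, hm.congr (fun _ => Iff.rfl) (fun w _ => ?_) fun _ => Iff.rfl⟩,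
      Or.inl ⟨rfl, ?_, le_rfl⟩⟩
    · simp
    · simp only [potential, List.length_nil]; omega
  | cons w ws =>
    have hn' := List.nodup_cons.1 hn
    have hin := hm.inTau_iff w
    simp only [step] at hc
    split_ifs at hc with hw <;> cases hc
    · refine ⟨⟨hs, hn'.2, hm.congr (fun _ => Iff.rfl) (fun u hu => ?_) fun _ => Iff.rfl⟩,
        Or.inl ⟨rfl, ?_, le_rfl⟩⟩
      · grind
      · simp only [potential, List.length_cons]; omega
    · have hw' : w ∉ path (f :: fs) := by grind
      refine ⟨⟨hs, hn'.2, (hm.move hw').congr (fun _ => Iff.rfl) (fun u hu => ?_)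
        fun _ => Iff.rfl⟩, Or.inl ⟨by simp, ?_, le_rfl⟩⟩
      · have hi := hm.idx_eq w hw'
        simp only [Function.update_apply]
        grind
      · simp only [potential, List.length_cons]; omega

theorem advances_restore (h : Inv I ⟨.restore, f :: fs, M⟩) (hI : I.Represents G)
    (hc : step I ⟨.restore, f :: fs, M⟩ = some c) : Advances I ⟨.restore, f :: fs, M⟩ c := by
  dsimp only [Inv] at h
  obtain ⟨hs, hm⟩ := h
  have hx := hs.1.notMem f.x (by simp)
  have hl := hs.1.label_eq f.x (by simp)
  have hm' : ((M.insert f.i f.x).pop f.x).Stable I (path fs) := by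
    refine ((hm.insert (w := f.x) (j := f.i) (by simp [path])).pop hx).congr ?_ ?_
      fun _ => Iff.rfl
    · intro w; simp only [path, List.map_cons, List.mem_cons] at hx ⊢; grind
    · intro w _; simp only [Function.update_apply]; grind
  have hr := add_loopCost_le hI hs
  simp only [step] at hc
  split_ifs at hc with hv <;> cases hc
  · refine ⟨⟨⟨⟨?_, ?_, hs.1.label_le, by simp⟩, hs.2⟩, (hm'.set_mark true).congr
      (fun _ => Iff.rfl) (fun _ _ => rfl) ?_⟩, Or.inl ⟨by simp [Mem.pop], ?_, ?_⟩⟩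
    · simpa using hx
    · simpa using hl
    · simp
    · simp only [potential, loopCost_of_eq_nil, hv]
      simp; omega
    · simp [remaining, pendingOutputs, Frame.pending, hv]
  · refine ⟨⟨hs, hm'⟩, Or.inl ⟨by simp [Mem.pop], ?_, ?_⟩⟩
    · simp only [potential]
      by_cases h0 : f.R = []
      · rw [loopCost_of_eq_nil h0]; omega
      · rw [loopCost_of_ne_nil h0]; omega
    · simp [remaining, pendingOutputs, Frame.pending, hv]

theorem advances_searchVert {todo : List V} (h : Inv I ⟨.searchVert todo, f :: fs, M⟩)
    (hI : I.Represents G) (hc : step I ⟨.searchVert todo, f :: fs, M⟩ = some c) :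
    Advances I ⟨.searchVert todo, f :: fs, M⟩ c := by
  dsimp only [Inv] at h
  obtain ⟨hs, hm⟩ := h
  cases todo with
  | nil =>
    simp only [step] at hc
    cases hc
    refine ⟨⟨hs, hs.1.nodup, hm⟩, Or.inl ⟨rfl, ?_, ?_⟩⟩
    · simp only [potential, List.length_cons]; omega
    · simp only [remaining]
      gcongr
      exact hI.length_le hs.1.nodup.of_cons
  | cons u todo =>
    simp only [step] at hc
    cases hc
    refine ⟨⟨hs, hm⟩, Or.inl ⟨rfl, ?_, le_rfl⟩⟩
    simp only [potential, List.map_cons, List.sum_cons]; omega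

theorem advances_searchNbr {ws todo : List V} (h : Inv I ⟨.searchNbr ws todo, f :: fs, M⟩)
    (hI : I.Represents G) (hc : step I ⟨.searchNbr ws todo, f :: fs, M⟩ = some c) :
    Advances I ⟨.searchNbr ws todo, f :: fs, M⟩ c := by
  dsimp only [Inv] at h
  obtain ⟨hs, hm⟩ := h
  cases ws with
  | nil =>
    simp only [step] at hc
    cases hc
    refine ⟨⟨hs, hm⟩, Or.inl ⟨rfl, ?_, le_rfl⟩⟩
    simp only [potential, List.length_nil]; omega
  | cons w ws =>
    simp only [step] at hc
    split_ifs at hc with hw <;> cases hc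
    · obtain ⟨ht, hi, hk⟩ := hw
      have ht' : w ∉ path fs := by have := hm.inTau_iff w; grind
      have hl : label I (path fs) w = f.i := (hm.idx_eq w ht').symm.trans hi
      have hk' : w ∉ f.v :: f.R := by have := hm.mark_iff w; grind
      have hsc := searchCost_mark (I := I) hk
      have hle := searchCost_le (I := I) M
      have hr := add_loopCost_le hI hs
      have h1 := hs.1.notMem
      have h2 := hs.1.label_eq
      have h3 := hs.1.nodup
      refine ⟨⟨⟨⟨?_, ?_, hs.1.label_le, ?_⟩, hs.2⟩, (hm.set_mark true).congr
        (fun _ => Iff.rfl) (fun _ _ => rfl) ?_⟩, Or.inl ⟨rfl, ?_, le_rfl⟩⟩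
      · grind
      · grind
      · grind
      · grind
      · simp only [potential, List.map_cons, List.sum_cons, List.length_cons]
        rw [loopCost_of_ne_nil (f := { f with R := w :: f.R }) (by simp), if_neg (by simp)]
        by_cases h0 : f.R = []
        -- the first vertex found: the reserve pays for the search and for what follows
        · rw [loopCost_of_eq_nil h0, if_pos h0, h0, List.length_nil]; dsimp only; omega
        · rw [loopCost_of_ne_nil h0, if_neg h0]; dsimp only; omega
    · refine ⟨⟨hs, hm⟩, Or.inl ⟨rfl, ?_, le_rfl⟩⟩
      simp only [potential, List.length_cons]; omega

theorem advances_unmark {ws : List V} (h : Inv I ⟨.unmark ws, f :: fs, M⟩)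
    (hc : step I ⟨.unmark ws, f :: fs, M⟩ = some c) :
    Advances I ⟨.unmark ws, f :: fs, M⟩ c := by
  dsimp only [Inv] at h
  obtain ⟨hs, hn, hm⟩ := h
  cases ws with
  | nil =>
    simp only [step] at hc
    cases hc
    refine ⟨⟨hs, hm.congr (fun _ => Iff.rfl) (fun _ _ => rfl) (by simp)⟩,
      Or.inl ⟨rfl, ?_, le_rfl⟩⟩
    simp only [potential, List.length_nil]; omega
  | cons w ws =>
    have hn' := List.nodup_cons.1 hn
    simp only [step] at hc
    cases hc
    refine ⟨⟨hs, hn'.2, (hm.set_mark false).congr (fun _ => Iff.rfl) (fun _ _ => rfl) ?_⟩,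
      Or.inl ⟨rfl, ?_, le_rfl⟩⟩
    · grind
    · simp only [potential, List.length_cons]; omega

theorem advances_loopTest (h : Inv I ⟨.loopTest, f :: fs, M⟩)
    (hc : step I ⟨.loopTest, f :: fs, M⟩ = some c) : Advances I ⟨.loopTest, f :: fs, M⟩ c := by
  dsimp only [Inv] at h
  obtain ⟨hs, hm⟩ := h
  simp only [step] at hc
  split at hc <;> rename_i hR <;> cases hc
  · refine ⟨⟨hs.2, hm⟩, Or.inl ⟨rfl, ?_, ?_⟩⟩
    · simp only [potential, loopCost_of_eq_nil hR]; omega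
    · simp only [remaining]; omega
  · rename_i y R
    have h1 := hs.1.notMem
    have h2 := hs.1.label_eq
    have h3 := hs.1.nodup
    rw [hR] at h1 h2 h3
    have hy : y ≠ f.v := by grind
    refine ⟨⟨⟨⟨?_, ?_, hs.1.label_le, ?_⟩, hs.2⟩, hm⟩, Or.inl ⟨rfl, ?_, ?_⟩⟩
    · grind
    · grind
    · grind
    · simp only [potential]
      rw [loopCost_of_ne_nil (by simp [hR])]; omega
    · simp only [remaining, pendingOutputs, Frame.pending, hR, List.length_cons, if_neg hy]
      rw [add_one_mul]; omega

/-- Every step from a configuration with the invariant advances. -/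
theorem advances_of_step (hI : I.Represents G) {c c' : Config V} (h : Inv I c)
    (hc : step I c = some c') : Advances I c c' := by
  obtain ⟨pc, st, M⟩ := c
  cases pc with
  | initSets j => exact advances_initSets h hI hc
  | initVerts vs => exact advances_initVerts h hc
  | call k => exact advances_call h hI hc
  | scan k => exact advances_scan h hI hc
  | outVert us buf => exact advances_outVert h hc
  | outNbr u ws us buf => exact advances_outNbr h hc
  | ret =>
    cases st with
    | nil => simp [step] at hc
    | cons f fs => exact advances_ret h hI hc
  | remove => cases st with
    | nil => exact h.elim
    | cons f fs => exact advances_remove h hc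
  | append => cases st with
    | nil => exact h.elim
    | cons f fs => exact advances_append h hI hc
  | forward ws => cases st with
    | nil => exact h.elim
    | cons f fs => exact advances_forward h hc
  | backward ws => cases st with
    | nil => exact h.elim
    | cons f fs => exact advances_backward h hc
  | restore => cases st with
    | nil => exact h.elim
    | cons f fs => exact advances_restore h hI hc
  | searchVert todo => cases st with
    | nil => exact h.elim
    | cons f fs => exact advances_searchVert h hI hc
  | searchNbr ws todo => cases st with
    | nil => exact h.elim
    | cons f fs => exact advances_searchNbr h hI hc
  | unmark ws => cases st with
    | nil => exact h.elim
    | cons f fs => exact advances_unmark h hc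
  | loopTest => cases st with
    | nil => exact h.elim
    | cons f fs => exact advances_loopTest h hc

end Step

/-! ### From the potential to the delay -/

theorem configAt_succ_of_step {I : AdjLists V} {t : ℕ} {c : Config V}
    (h : step I (configAt I t) = some c) : configAt I (t + 1) = c := by
  unfold configAt at *
  rw [Function.iterate_succ_apply', h, Option.getD_some]

theorem configAt_succ_of_step_eq_none {I : AdjLists V} {t : ℕ}
    (h : step I (configAt I t) = none) : configAt I (t + 1) = configAt I t := by
  unfold configAt at *
  rw [Function.iterate_succ_apply', h, Option.getD_none]

theorem configAt_eq_of_step_eq_none {I : AdjLists V} {s t : ℕ} (hst : s ≤ t)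
    (h : step I (configAt I s) = none) : configAt I t = configAt I s := by
  induction t, hst using Nat.le_induction with
  | base => rfl
  | succ t _ ih => rw [configAt_succ_of_step_eq_none (by rwa [ih]), ih]

/-- The program has not terminated before an event. -/
theorem IsEvent.step_ne_none {I : AdjLists V} {s t : ℕ} (ht : IsEvent I t) (hst : s < t) :
    step I (configAt I s) ≠ none := by
  intro h
  rcases ht with rfl | ⟨r, rfl, hr⟩ | ⟨-, hr⟩
  · omega
  · rw [configAt_eq_of_step_eq_none (t := r) (by omega) h,
      configAt_eq_of_step_eq_none (t := r + 1) (by omega) h] at hr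
    exact hr.false
  · exact hr s hst h

section

variable [Fintype V] {I : AdjLists V} {G : SimpleGraph V}

theorem inv_configAt (hI : I.Represents G) (t : ℕ) : Inv I (configAt I t) := by
  induction t with
  | zero =>
    exact ⟨rfl, rfl, by simp [configAt, start, Mem.blank],
      ⟨by simp [configAt, start, Mem.blank], by simp, by simp, by simp, 0, by simp⟩, by simp,
      by simp [configAt, start, Mem.blank]⟩
  | succ t ih =>
    cases h : step I (configAt I t) with
    | none => rwa [configAt_succ_of_step_eq_none h]
    | some c => rw [configAt_succ_of_step h]; exact (advances_of_step hI ih h).inv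

theorem advances_configAt (hI : I.Represents G) {t : ℕ} (h : step I (configAt I t) ≠ none) :
    Advances I (configAt I t) (configAt I (t + 1)) := by
  obtain ⟨c, hc⟩ := Option.ne_none_iff_exists'.1 h
  rw [configAt_succ_of_step hc]
  exact advances_of_step hI (inv_configAt hI t) hc

theorem potential_configAt_le [Nonempty V] (hI : I.Represents G) (t : ℕ) :
    potential I (configAt I t) ≤ delayBound I := by
  induction t with
  | zero =>
    have := descentCost_le (I := I) []
    have hn := hI.length_verts
    have hpos : 0 < Fintype.card V := Fintype.card_pos
    simp only [Finset.sum_add_distrib, Finset.sum_const, Finset.card_univ, smul_eq_mul]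
      at this
    simp only [configAt, Function.iterate_zero, id, start, potential, path, List.map_nil,
      delayBound, reserve, Finset.sum_add_distrib, Finset.sum_const, Finset.card_univ,
      smul_eq_mul, ← Finset.mul_sum, ← hn]
    omega
  | succ t ih =>
    cases h : step I (configAt I t) with
    | none => rwa [configAt_succ_of_step_eq_none h]
    | some c =>
      rcases (advances_configAt hI (t := t) (by simp [h])).cost with h1 | h1
      · exact h1.2.1.le.trans ih
      · exact h1.2.1

/-- The program terminates: the pair of the bound for the number of outputs to come and the
potential decreases lexicographically. -/
theorem exists_haltsAt (hI : I.Represents G) : ∃ T, HaltsAt I T := by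
  by_cases hex : ∃ t, step I (configAt I t) = none
  · classical
    exact ⟨Nat.find hex, Nat.find_spec hex, fun s hs => Nat.find_min hex hs⟩
  · push Not at hex
    exfalso
    -- the lexicographic order is encoded in `ℕ`, as the potential is at most `delayBound`
    have hdec : ∀ t, remaining I (configAt I (t + 1)) * (delayBound I + 1) +
        potential I (configAt I (t + 1)) <
        remaining I (configAt I t) * (delayBound I + 1) + potential I (configAt I t) := by
      intro t
      rcases (advances_configAt hI (hex t)).cost with ⟨-, h1, h2⟩ | ⟨-, h1, h2⟩
      · have := Nat.mul_le_mul_right (delayBound I + 1) h2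
        omega
      · have := Nat.mul_le_mul_right (delayBound I + 1) (Nat.succ_le_of_lt h2)
        rw [Nat.succ_mul] at this
        omega
    exact not_strictAnti_of_wellFoundedLT (fun t => remaining I (configAt I t) *
      (delayBound I + 1) + potential I (configAt I t)) (strictAnti_nat_of_succ_lt hdec)

/-- Between two consecutive events only the last step can make an output, so that the potential
drops in all others. -/
theorem sub_le_of_isEvent [Nonempty V] (hI : I.Represents G) {s t : ℕ} (ht : IsEvent I t)
    (hst : s < t) (hno : ∀ r, s < r → r < t → ¬ IsEvent I r) : t - s ≤ delayBound I + 1 := by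
  have key : ∀ k, s + k < t →
      potential I (configAt I (s + k)) + k ≤ potential I (configAt I s) := by
    intro k
    induction k with
    | zero => simp
    | succ k ih =>
      intro hk
      have h1 := ih (by omega)
      rcases (advances_configAt hI (ht.step_ne_none (show s + k < t by omega))).cost with h2 | h2
      · rw [show s + (k + 1) = s + k + 1 from rfl]; omega
      · exact absurd (Or.inr (Or.inl ⟨s + k, rfl, by omega⟩)) (hno (s + k + 1) (by omega) hk)
  have h1 := key (t - 1 - s) (by omega)
  have h2 := potential_configAt_le hI s
  omega

theorem delayBound_add_one_le [Nonempty V] [DecidableRel G.Adj] (hI : I.Represents G) :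
    delayBound I + 1 ≤ 24 * (Fintype.card V + G.edgeFinset.card) := by
  have hd : ∀ u, (I.adj u).length = G.degree u := by
    intro u
    rw [← List.toFinset_card_of_nodup (hI.adj_nodup u), ← G.card_neighborFinset_eq_degree]
    congr 1
    ext w
    simp [hI.mem_adj]
  have hv : I.verts.toFinset = Finset.univ := by ext u; simp [hI.mem_verts]
  have ho : outputCost I I.verts = ∑ u, ((I.adj u).length + 2) + 1 := by
    rw [outputCost, ← List.sum_toFinset _ hI.verts_nodup, hv]
  have hn : 0 < Fintype.card V := Fintype.card_pos
  simp only [delayBound, reserve, ho, hI.length_verts, hd, Finset.sum_add_distrib,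
    ← Finset.mul_sum, G.sum_degrees_eq_twice_card_edges, Finset.sum_const, Finset.card_univ,
    smul_eq_mul]
  omega

end

end McsEnum

theorem mainTheorem2 :
    ∃ C : ℕ, ∀ (V : Type*) [Fintype V] [DecidableEq V] [Nonempty V]
      (G : SimpleGraph V) [DecidableRel G.Adj] (I : AdjLists V),
      IsChordal G → I.Represents G →
        McsEnum.DelayAtMost I (C * (Fintype.card V + G.edgeFinset.card)) := by
  refine ⟨24, fun V _ _ _ G _ I _ hI => ⟨McsEnum.exists_haltsAt hI, fun s t _ ht hst hno => ?_⟩⟩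
  exact (McsEnum.sub_le_of_isEvent hI ht hst hno).trans (McsEnum.delayBound_add_one_le hI)
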